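/- Consider the barrier $B=[0,L]$ with $L>0$ and $n$ sensors $s_1,\dots,s_n$ on the $x$-axis with initial positions $x_1\le x_2\le\cdots\le x_n$, all with the same range $r>0$, where $2nr\ge L$. A sensor at position $y$ covers the interval $[y-r,y+r]$. The uniform case of the barrier coverage problem on a line segment asks for destinations $y_1,\dots,y_n\in\mathbb{R}$ such that every point of $B$ is covered by at least one sensor and the maximum moving distance $\max_{1\le i\le n}|x_i-y_i|$ is as small as possible. This problem is solvable in $O(n\log n)$ time: there is an algorithm (a single program for a real RAM with unit-cost operations) that, on every such input, halts after $O(n\log n)$ steps and outputs optimal destinations $y_1,\dots,y_n$ together with the optimal value $\lambda^*$ of the maximum moving distance, where the bound on the number of steps depends only on $n$. -/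

import Mathlib

namespace BarrierCoverage

/-! ## The real RAM

Structured programs for a real random access machine with unit costs. The machine has scalar
variables and arrays (unbounded, indexed by natural numbers), each kind once for natural numbers
(used for indices and counters) and once for exact real numbers. On naturals it can add, subtract
(truncated at zero), halve (rounding down) and compare; on reals it can add, subtract, multiply
and compare. A natural number can be converted into a real one, but there is no rounding of reals
to naturals. A program is a finite piece of text, so it mentions finitely many variables and
arrays, and its constants are natural or rational literals. -/

/-- The memory of the machine: scalar variables and arrays of naturals and of reals. -/
structure Store where
  natVar : ℕ → ℕ
  realVar : ℕ → ℝ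
  natArr : ℕ → ℕ → ℕ
  realArr : ℕ → ℕ → ℝ

/-- Expressions for natural numbers; `get a i` reads entry `i` of the array named `a`. -/
inductive NatExp where
  | lit (k : ℕ)
  | var (v : ℕ)
  | get (a : ℕ) (i : NatExp)
  | add (e f : NatExp)
  | sub (e f : NatExp)
  | half (e : NatExp)

/-- Expressions for real numbers; `ofNatExp` converts a natural number into a real one. -/
inductive RealExp where
  | lit (q : ℚ)
  | var (v : ℕ)
  | get (a : ℕ) (i : NatExp)
  | ofNatExp (e : NatExp)
  | add (e f : RealExp)
  | sub (e f : RealExp)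
  | mul (e f : RealExp)

/-- Tests. -/
inductive Test where
  | natLE (e f : NatExp)
  | realLE (e f : RealExp)
  | not (b : Test)
  | and (b c : Test)

/-- Programs. -/
inductive Prog where
  | skip
  | setNat (v : ℕ) (e : NatExp)
  | setReal (v : ℕ) (e : RealExp)
  | putNat (a : ℕ) (i e : NatExp)
  | putReal (a : ℕ) (i : NatExp) (e : RealExp)
  | seq (P Q : Prog)
  | ite (b : Test) (P Q : Prog)
  | loop (b : Test) (P : Prog)

/-- The value of an expression. -/
def NatExp.eval (s : Store) : NatExp → ℕ
  | lit k => k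
  | var v => s.natVar v
  | get a i => s.natArr a (i.eval s)
  | add e f => e.eval s + f.eval s
  | sub e f => e.eval s - f.eval s
  | half e => e.eval s / 2

/-- The number of operations needed to evaluate an expression: each literal, each memory access
and each arithmetic operation costs one step. -/
def NatExp.cost : NatExp → ℕ
  | lit _ => 1
  | var _ => 1
  | get _ i => i.cost + 1
  | add e f => e.cost + f.cost + 1
  | sub e f => e.cost + f.cost + 1
  | half e => e.cost + 1

/-- The value of an expression. -/
noncomputable def RealExp.eval (s : Store) : RealExp → ℝ
  | lit q => (q : ℝ)
  | var v => s.realVar v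
  | get a i => s.realArr a (i.eval s)
  | ofNatExp e => (e.eval s : ℝ)
  | add e f => e.eval s + f.eval s
  | sub e f => e.eval s - f.eval s
  | mul e f => e.eval s * f.eval s

/-- The number of operations needed to evaluate an expression. -/
def RealExp.cost : RealExp → ℕ
  | lit _ => 1
  | var _ => 1
  | get _ i => i.cost + 1
  | ofNatExp e => e.cost + 1
  | add e f => e.cost + f.cost + 1
  | sub e f => e.cost + f.cost + 1
  | mul e f => e.cost + f.cost + 1

/-- The outcome of a test. -/
def Test.holds (s : Store) : Test → Prop
  | natLE e f => e.eval s ≤ f.eval s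
  | realLE e f => e.eval s ≤ f.eval s
  | not b => ¬ b.holds s
  | and b c => b.holds s ∧ c.holds s

/-- The number of operations needed to carry out a test. -/
def Test.cost : Test → ℕ
  | natLE e f => e.cost + f.cost + 1
  | realLE e f => e.cost + f.cost + 1
  | not b => b.cost + 1
  | and b c => b.cost + c.cost + 1

/-- Assignments to variables and to entries of arrays. -/
def Store.setNat (s : Store) (v k : ℕ) : Store :=
  { s with natVar := Function.update s.natVar v k }

/-- Assignments to variables and to entries of arrays. -/
noncomputable def Store.setReal (s : Store) (v : ℕ) (c : ℝ) : Store :=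
  { s with realVar := Function.update s.realVar v c }

/-- Assignments to variables and to entries of arrays. -/
def Store.putNat (s : Store) (a i k : ℕ) : Store :=
  { s with natArr := Function.update s.natArr a (Function.update (s.natArr a) i k) }

/-- Assignments to variables and to entries of arrays. -/
noncomputable def Store.putReal (s : Store) (a i : ℕ) (c : ℝ) : Store :=
  { s with realArr := Function.update s.realArr a (Function.update (s.realArr a) i c) }

/-- `Exec P s t s'`: the program `P`, started with memory `s`, halts after exactly `t` steps with
memory `s'`. -/
inductive Exec : Prog → Store → ℕ → Store → Prop where
  | skip (s : Store) : Exec .skip s 1 s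
  | setNat (s : Store) (v : ℕ) (e : NatExp) :
      Exec (.setNat v e) s (e.cost + 1) (s.setNat v (e.eval s))
  | setReal (s : Store) (v : ℕ) (e : RealExp) :
      Exec (.setReal v e) s (e.cost + 1) (s.setReal v (e.eval s))
  | putNat (s : Store) (a : ℕ) (i e : NatExp) :
      Exec (.putNat a i e) s (i.cost + e.cost + 1) (s.putNat a (i.eval s) (e.eval s))
  | putReal (s : Store) (a : ℕ) (i : NatExp) (e : RealExp) :
      Exec (.putReal a i e) s (i.cost + e.cost + 1) (s.putReal a (i.eval s) (e.eval s))
  | seq {P Q : Prog} {s s₁ s₂ : Store} {t₁ t₂ : ℕ} :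
      Exec P s t₁ s₁ → Exec Q s₁ t₂ s₂ → Exec (.seq P Q) s (t₁ + t₂) s₂
  | iteTrue {b : Test} {P Q : Prog} {s s' : Store} {t : ℕ} :
      b.holds s → Exec P s t s' → Exec (.ite b P Q) s (b.cost + 1 + t) s'
  | iteFalse {b : Test} {P Q : Prog} {s s' : Store} {t : ℕ} :
      ¬ b.holds s → Exec Q s t s' → Exec (.ite b P Q) s (b.cost + 1 + t) s'
  | loopDone {b : Test} {P : Prog} {s : Store} :
      ¬ b.holds s → Exec (.loop b P) s (b.cost + 1) s
  | loopStep {b : Test} {P : Prog} {s s₁ s₂ : Store} {t₁ t₂ : ℕ} :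
      b.holds s → Exec P s t₁ s₁ → Exec (.loop b P) s₁ t₂ s₂ →
      Exec (.loop b P) s (b.cost + 1 + t₁ + t₂) s₂

/-! ## Barrier coverage on a line segment -/

/-- An instance with `n` sensors: the barrier is `[0, L]`, sensor `i` has initial position `x i`
and range `r i`. The sensors are listed from left to right, and their ranges suffice to cover the
barrier. -/
structure Instance (n : ℕ) where
  L : ℝ
  x : Fin n → ℝ
  r : Fin n → ℝ
  L_pos : 0 < L
  r_pos : ∀ i, 0 < r i
  x_mono : Monotone x
  enough : L ≤ 2 * ∑ i, r i

namespace Instance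

variable {n : ℕ} (I : Instance n)

/-- The uniform case: all ranges are equal. -/
def Uniform : Prop := ∀ i j, I.r i = I.r j

/-- With sensor `i` at `y i` for all `i`, each point of the barrier is covered by a sensor. -/
def Covers (y : Fin n → ℝ) : Prop :=
  ∀ p ∈ Set.Icc 0 I.L, ∃ i, p ∈ Set.Icc (y i - I.r i) (y i + I.r i)

/-- The maximum moving distance of the sensors for the destinations `y`. -/
noncomputable def maxMove (y : Fin n → ℝ) : ℝ := ⨆ i, |I.x i - y i|

/-- The destinations `y` solve the problem: they cover the barrier, with the least possible
maximum moving distance. -/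
def IsOptimal (y : Fin n → ℝ) : Prop :=
  I.Covers y ∧ ∀ z, I.Covers z → I.maxMove y ≤ I.maxMove z

/-- The initial memory: `n` in natural variable `0`, `L` in real variable `0`, the positions in
real array `0` and the ranges in real array `1`, at the indices `0, …, n - 1`; everything else
is zero. -/
noncomputable def input : Store where
  natVar v := if v = 0 then n else 0
  realVar v := if v = 0 then I.L else 0
  natArr _ _ := 0
  realArr a k :=
    if h : k < n then
      if a = 0 then I.x ⟨k, h⟩ else if a = 1 then I.r ⟨k, h⟩ else 0
    else 0

end Instance

/-- The output destinations: the entries `0, …, n - 1` of real array `2`. -/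
def Store.destinations (s : Store) (n : ℕ) : Fin n → ℝ := fun i => s.realArr 2 i

/-- The output value of the maximum moving distance: real variable `1`. -/
def Store.value (s : Store) : ℝ := s.realVar 1

end BarrierCoverage

namespace BarrierCoverage

/-! ## Loop-free programs and a rule for loops -/

/-! Sorting the destinations keeps a solution a solution (`abs_sub_sort_le`). For a fixed bound `μ`
on the moves, the sensors that can touch the barrier form a block `a, …, c - 1`. If `μ` is
achievable, this block is long enough and satisfies `Feasible` (`Achievable.feasible`); conversely,
these conditions let the greedy plan, with each sensor as far right as allowed, cover the barrier
(`Feasible.le_greedy`). They see the positions only through the maximum, the minimum and the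
greatest rise of `x i - 2 * r * i`, so the optimum `blockValue` of a block is updated in constant
time when a sensor joins at either end.

No search over `μ` is needed. The block starts empty, just before the first sensor at or right of
`-r`, and always takes the neighbour that needs the smaller move to touch the barrier. While the
block is too short or its value exceeds that need, every solution costs at least this need
(`Block.le_of_not_final`), so the new sensor can touch the barrier in every solution. Once the block
is final, its value is a lower bound (`Block.le_of_final`), which the greedy plan attains. Three
loops with at most `n` rounds of bounded cost give a linear running time. -/

/-- The program contains no loop. -/
def Prog.LoopFree : Prog → Prop
  | .seq P Q => P.LoopFree ∧ Q.LoopFree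
  | .ite _ P Q => P.LoopFree ∧ Q.LoopFree
  | .loop _ _ => False
  | _ => True

open Classical in
/-- The effect of a loop-free program on the memory. -/
noncomputable def Prog.run : Prog → Store → Store
  | .skip, s => s
  | .setNat v e, s => s.setNat v (e.eval s)
  | .setReal v e, s => s.setReal v (e.eval s)
  | .putNat a i e, s => s.putNat a (i.eval s) (e.eval s)
  | .putReal a i e, s => s.putReal a (i.eval s) (e.eval s)
  | .seq P Q, s => Q.run (P.run s)
  | .ite b P Q, s => if b.holds s then P.run s else Q.run s
  | .loop _ _, s => s

/-- An upper bound for the number of steps of a loop-free program. -/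
def Prog.bound : Prog → ℕ
  | .skip => 1
  | .setNat _ e => e.cost + 1
  | .setReal _ e => e.cost + 1
  | .putNat _ i e => i.cost + e.cost + 1
  | .putReal _ i e => i.cost + e.cost + 1
  | .seq P Q => P.bound + Q.bound
  | .ite b P Q => b.cost + 1 + (P.bound + Q.bound)
  | .loop _ _ => 0

theorem Prog.LoopFree.exists_exec {P : Prog} (hP : P.LoopFree) (s : Store) :
    ∃ t, Exec P s t (P.run s) ∧ t ≤ P.bound := by
  induction P generalizing s with
  | skip => exact ⟨_, .skip s, le_rfl⟩
  | setNat v e => exact ⟨_, .setNat s v e, le_rfl⟩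
  | setReal v e => exact ⟨_, .setReal s v e, le_rfl⟩
  | putNat a i e => exact ⟨_, .putNat s a i e, le_rfl⟩
  | putReal a i e => exact ⟨_, .putReal s a i e, le_rfl⟩
  | seq P Q ihP ihQ =>
    obtain ⟨t₁, h₁, l₁⟩ := ihP hP.1 s
    obtain ⟨t₂, h₂, l₂⟩ := ihQ hP.2 (P.run s)
    exact ⟨_, .seq h₁ h₂, add_le_add l₁ l₂⟩
  | ite b P Q ihP ihQ =>
    by_cases hb : b.holds s
    · obtain ⟨t, h, l⟩ := ihP hP.1 s
      refine ⟨b.cost + 1 + t, ?_, by simp only [Prog.bound]; omega⟩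
      simpa only [Prog.run, if_pos hb] using Exec.iteTrue hb h
    · obtain ⟨t, h, l⟩ := ihQ hP.2 s
      refine ⟨b.cost + 1 + t, ?_, by simp only [Prog.bound]; omega⟩
      simpa only [Prog.run, if_neg hb] using Exec.iteFalse hb h
  | loop b P => exact hP.elim

/-- A loop with a loop-free body, an invariant and a variant. -/
theorem exists_exec_loop {b : Test} {P : Prog} (hP : P.LoopFree) (Inv : Store → Prop)
    (m : Store → ℕ) (h : ∀ s, Inv s → b.holds s → Inv (P.run s) ∧ m (P.run s) < m s)
    (s : Store) (hs : Inv s) :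
    ∃ t s', Exec (.loop b P) s t s' ∧
      t ≤ (b.cost + 1 + P.bound) * m s + (b.cost + 1) ∧ Inv s' ∧ ¬ b.holds s' := by
  induction hk : m s using Nat.strong_induction_on generalizing s with
  | _ k ih =>
    subst hk
    by_cases hb : b.holds s
    · obtain ⟨hInv, hm⟩ := h s hs hb
      obtain ⟨t₁, e₁, l₁⟩ := hP.exists_exec s
      obtain ⟨t₂, s', e₂, l₂, hI, hn⟩ := ih _ hm _ hInv rfl
      refine ⟨_, s', .loopStep hb e₁ e₂, ?_, hI, hn⟩
      have : (b.cost + 1 + P.bound) * (m (P.run s) + 1) ≤ (b.cost + 1 + P.bound) * m s :=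
        Nat.mul_le_mul_left _ hm
      rw [mul_add, mul_one] at this
      omega
    · exact ⟨_, s, .loopDone hb, by omega, hs, hb⟩

/-- `v := max v e`. -/
def Prog.raise (v : ℕ) (e : RealExp) : Prog := .ite (.realLE (.var v) e) (.setReal v e) .skip

/-- `v := min v e`. -/
def Prog.lower (v : ℕ) (e : RealExp) : Prog := .ite (.realLE e (.var v)) (.setReal v e) .skip

@[simp] theorem Prog.loopFree_raise (v : ℕ) (e : RealExp) : (Prog.raise v e).LoopFree :=
  ⟨trivial, trivial⟩

@[simp] theorem Prog.loopFree_lower (v : ℕ) (e : RealExp) : (Prog.lower v e).LoopFree :=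
  ⟨trivial, trivial⟩

theorem Store.setReal_self (s : Store) (v : ℕ) : s.setReal v (s.realVar v) = s := by
  simp [Store.setReal]

@[simp] theorem Prog.run_raise (v : ℕ) (e : RealExp) (s : Store) :
    (Prog.raise v e).run s = s.setReal v (max (s.realVar v) (e.eval s)) := by
  by_cases h : s.realVar v ≤ e.eval s
  · simp [Prog.raise, Prog.run, Test.holds, RealExp.eval, h]
  · simp [Prog.raise, Prog.run, Test.holds, RealExp.eval, h, max_eq_left (not_le.1 h).le,
      s.setReal_self]

@[simp] theorem Prog.run_lower (v : ℕ) (e : RealExp) (s : Store) :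
    (Prog.lower v e).run s = s.setReal v (min (s.realVar v) (e.eval s)) := by
  by_cases h : e.eval s ≤ s.realVar v
  · simp [Prog.lower, Prog.run, Test.holds, RealExp.eval, h]
  · simp [Prog.lower, Prog.run, Test.holds, RealExp.eval, h, min_eq_left (not_le.1 h).le,
      s.setReal_self]

/-! ## Order-preserving solutions -/

/-- Pigeonhole: the indices `≥ i` cannot be injected into the indices `> i`. -/
theorem exists_ge_perm_le {n : ℕ} (σ : Equiv.Perm (Fin n)) (i : Fin n) : ∃ k, i ≤ k ∧ σ k ≤ i := by
  by_contra! h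
  have := Finset.card_le_card_of_injOn (s := Finset.Ici i) (t := Finset.Ioi i) σ
    (fun k hk => by simpa using h k (by simpa using hk)) σ.injective.injOn
  have hi := i.isLt
  simp only [Fin.card_Ici, Fin.card_Ioi] at this
  omega

theorem exists_le_perm_ge {n : ℕ} (σ : Equiv.Perm (Fin n)) (i : Fin n) : ∃ k, k ≤ i ∧ i ≤ σ k := by
  by_contra! h
  have := Finset.card_le_card_of_injOn (s := Finset.Iic i) (t := Finset.Iio i) σ
    (fun k hk => by simpa using h k (by simpa using hk)) σ.injective.injOn
  simp only [Fin.card_Iic, Fin.card_Iio] at this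
  omega

/-- Sorting the destinations of sorted points does not increase the maximum moving distance. -/
theorem abs_sub_sort_le {n : ℕ} {x y : Fin n → ℝ} {μ : ℝ} (hx : Monotone x)
    (h : ∀ i, |x i - y i| ≤ μ) (i : Fin n) : |x i - y (Tuple.sort y i)| ≤ μ := by
  have hm := Tuple.monotone_sort y
  rw [abs_le]
  constructor
  -- With `σ` the sorting permutation: `y (σ i) ≤ y (σ k) ≤ x (σ k) + μ ≤ x i + μ`.
  · obtain ⟨k, hk, hk'⟩ := exists_ge_perm_le (Tuple.sort y) i
    have h1 := hm hk
    have h2 := (abs_le.1 (h (Tuple.sort y k))).1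
    have h3 := hx hk'
    simp only [Function.comp] at h1
    linarith
  · obtain ⟨k, hk, hk'⟩ := exists_le_perm_ge (Tuple.sort y) i
    have h1 := hm hk
    have h2 := (abs_le.1 (h (Tuple.sort y k))).2
    have h3 := hx hk'
    simp only [Function.comp] at h1
    linarith

/-! ## Covering with a block of consecutive sensors -/

/-- The `n` sensors of range `r` at the points `x i` can cover `[0, L]` by moving at most `μ`. -/
def Achievable (n : ℕ) (L r : ℝ) (x : ℕ → ℝ) (μ : ℝ) : Prop :=
  ∃ y : Fin n → ℝ, (∀ p ∈ Set.Icc 0 L, ∃ i, p ∈ Set.Icc (y i - r) (y i + r)) ∧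
    ∀ i : Fin n, |x i - y i| ≤ μ

/-- The inequalities that allow the sensors `a, …, c - 1` to cover `[0, L]` in this order by
moving at most `μ`, when `L ≤ 2 r (c - a)`. -/
structure Feasible (L r : ℝ) (x : ℕ → ℝ) (a c : ℕ) (μ : ℝ) : Prop where
  first : ∀ j, a ≤ j → j < c → x j - 2 * r * j + 2 * r * a - r ≤ μ
  pair : ∀ i j, a ≤ i → i ≤ j → j < c → (x j - 2 * r * j) - (x i - 2 * r * i) ≤ 2 * μ
  last : ∀ i, a ≤ i → i < c → L + r - 2 * r * c - (x i - 2 * r * i) ≤ μ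

theorem le_add_mul_of_step {z : ℕ → ℝ} {d : ℝ} {a c : ℕ}
    (h : ∀ i, a ≤ i → i + 1 < c → z (i + 1) ≤ z i + d) {i j : ℕ} (hi : a ≤ i) (hij : i ≤ j)
    (hj : j < c) : z j ≤ z i + d * (j - i) := by
  induction j, hij using Nat.le_induction with
  | base => simp
  | succ j hij ih =>
    have h1 := ih (by omega)
    have h2 := h j (by omega) hj
    push_cast
    linarith

/-- If the sensors outside the block cannot reach the barrier by moving at most `μ`, and those of
the block can, then the block satisfies the inequalities. -/
theorem feasible_of_monotone {n : ℕ} {L r μ : ℝ} {x y : ℕ → ℝ} {a c : ℕ} (hL : 0 < L)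
    (hr : 0 < r) (hy : ∀ i j, i ≤ j → j < n → y i ≤ y j)
    (hcov : ∀ p ∈ Set.Icc 0 L, ∃ i < n, p ∈ Set.Icc (y i - r) (y i + r))
    (hmove : ∀ i < n, |x i - y i| ≤ μ) (hac : a ≤ c) (hcn : c ≤ n)
    (hleft : ∀ i < a, μ < -r - x i) (hright : ∀ i, c ≤ i → i < n → μ < x i - L - r)
    (hin : ∀ i, a ≤ i → i < c → -r - x i ≤ μ ∧ x i - L - r ≤ μ) :
    L ≤ 2 * r * (c - a : ℝ) ∧ Feasible L r x a c μ := by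
  have gap : ∀ k p, 0 ≤ p → p ≤ L → (∀ i < k, i < n → y i + r < p) →
      (∀ i, k ≤ i → i < n → p < y i - r) → False := by
    intro k p h0 h1 h2 h3
    obtain ⟨i, hi, h4, h5⟩ := hcov p ⟨h0, h1⟩
    rcases lt_or_ge i k with h | h
    · linarith [h2 i h hi]
    · linarith [h3 i h hi]
  have hyl : ∀ i < a, y i < -r := fun i hi => by
    linarith [hleft i hi, (abs_le.1 (hmove i (by omega))).1]
  have hyr : ∀ i, c ≤ i → i < n → L + r < y i := fun i hi hin => by
    linarith [hright i hi hin, (abs_le.1 (hmove i hin)).2]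
  have hlt : a < c := by
    rcases hac.lt_or_eq with h | rfl
    · exact h
    · exact (gap a 0 le_rfl hL.le (fun i hi _ => by linarith [hyl i hi])
        (fun i hi hn => by linarith [hyr i hi hn])).elim
  -- Clamping to `[-r, L + r]`, the positions from which a sensor touches the barrier, makes
  -- consecutive gaps at most `2 * r` even where `y` leaves that interval. By `hin`, the moves
  -- within the block stay bounded by `μ`.
  obtain ⟨z, hz⟩ : ∃ z : ℕ → ℝ, ∀ i, z i = max (-r) (min (y i) (L + r)) := ⟨_, fun _ => rfl⟩
  have hz1 : ∀ i, -r ≤ z i := fun i => by rw [hz]; exact le_max_left _ _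
  have hz2 : ∀ i, z i ≤ L + r := fun i => by
    rw [hz]; exact max_le (by linarith) (min_le_right _ _)
  have hz3 : ∀ i, z i < L + r → y i ≤ z i := fun i hi => by
    rw [hz] at hi ⊢
    have := (max_lt_iff.1 hi).2
    rcases min_lt_iff.1 this with h | h
    · rw [min_eq_left h.le]; exact le_max_right _ _
    · exact (lt_irrefl _ h).elim
  have hz4 : ∀ i, -r < z i → z i ≤ y i := fun i hi => by
    rw [hz] at hi ⊢
    rcases lt_max_iff.1 hi with h | h
    · exact (lt_irrefl _ h).elim
    · rw [max_eq_right h.le]; exact min_le_left _ _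
  have hstep : ∀ i, a ≤ i → i + 1 < c → z (i + 1) ≤ z i + 2 * r := by
    intro i hi hic
    by_contra! hlt'
    have e1 := hz3 i (by linarith [hz2 (i + 1)])
    have e2 := hz4 (i + 1) (by linarith [hz1 i])
    -- A gap above `2 * r` would leave its midpoint, a point of the barrier, uncovered.
    refine gap (i + 1) ((z i + z (i + 1)) / 2) ?_ ?_ ?_ ?_
    · linarith [hz1 i]
    · linarith [hz2 (i + 1)]
    · intro j hj _
      linarith [hy j i (by omega) (by omega)]
    · intro j hj hjn
      linarith [hy (i + 1) j hj hjn]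
  have hfirst : z a ≤ r := by
    by_contra! h
    have e2 := hz4 a (by linarith)
    -- Halfway between `0` and the left end of sensor `a`; the earlier sensors do not reach `0`.
    refine gap a ((z a - r) / 2) (by linarith) (by linarith [hz2 a]) ?_ ?_
    · intro j hj _
      linarith [hyl j hj]
    · intro j hj hjn
      linarith [hy a j hj hjn]
  have hlast : L - r ≤ z (c - 1) := by
    by_contra! h
    have e2 := hz3 (c - 1) (by linarith)
    refine gap c ((z (c - 1) + r + L) / 2) (by linarith [hz1 (c - 1)]) (by linarith) ?_ ?_
    · intro j hj _
      linarith [hy j (c - 1) (by omega) (by omega)]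
    · intro j hj hjn
      linarith [hyr j hj hjn]
  have hzx : ∀ i, a ≤ i → i < c → x i - μ ≤ z i ∧ z i ≤ x i + μ := by
    intro i hi hic
    obtain ⟨h1, h2⟩ := hin i hi hic
    obtain ⟨h3, h4⟩ := abs_le.1 (hmove i (by omega))
    rw [hz]
    refine ⟨le_max_of_le_right (le_min ?_ ?_), max_le ?_ (min_le_of_left_le ?_)⟩ <;> linarith
  have hchain := fun i j hi hij hj => le_add_mul_of_step (i := i) (j := j) hstep hi hij hj
  have hc1 : ((c - 1 : ℕ) : ℝ) = c - 1 := by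
    rw [Nat.cast_sub (by omega)]; simp
  refine ⟨?_, ?_, ?_, ?_⟩
  · have := hchain a (c - 1) le_rfl (by omega) (by omega)
    rw [hc1] at this
    linarith
  · intro j hj hjc
    linarith [hchain a j le_rfl hj hjc, hzx j hj hjc]
  · intro i j hi hij hj
    linarith [hchain i j hi hij hj, hzx j (by omega) hj, hzx i hi (by omega)]
  · intro i hi hic
    have := hchain i (c - 1) hi (by omega) (by omega)
    rw [hc1] at this
    linarith [hzx i hi hic]

theorem Achievable.feasible {n : ℕ} {L r μ : ℝ} {x : ℕ → ℝ} {a c : ℕ}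
    (h : Achievable n L r x μ) (hL : 0 < L) (hr : 0 < r) (hx : ∀ i j, i ≤ j → j < n → x i ≤ x j)
    (hac : a ≤ c) (hcn : c ≤ n)
    (hleft : ∀ i < a, μ < -r - x i) (hright : ∀ i, c ≤ i → i < n → μ < x i - L - r)
    (hin : ∀ i, a ≤ i → i < c → -r - x i ≤ μ ∧ x i - L - r ≤ μ) :
    L ≤ 2 * r * (c - a : ℝ) ∧ Feasible L r x a c μ := by
  obtain ⟨y, hcov, hmove⟩ := h
  have hs := abs_sub_sort_le (x := fun i : Fin n => x i) (fun i j hij => hx i j hij j.isLt) hmove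
  have hm := Tuple.monotone_sort y
  -- The default `0` is harmless: the conditions on `y` only concern indices below `n`.
  refine feasible_of_monotone (y := fun k => if h : k < n then y (Tuple.sort y ⟨k, h⟩) else 0)
    hL hr ?_ ?_ ?_ hac hcn hleft hright hin
  · intro i j hij hj
    simp only [hj, hij.trans_lt hj, dif_pos]
    exact hm (show (⟨i, _⟩ : Fin n) ≤ ⟨j, hj⟩ from hij)
  · intro p hp
    obtain ⟨i, hi⟩ := hcov p hp
    refine ⟨(Tuple.sort y).symm i, Fin.isLt _, ?_⟩
    simpa using hi
  · intro i hi
    simpa only [hi, dif_pos] using hs ⟨i, hi⟩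

/-! ### Sufficiency of the inequalities: greedy placement -/

/-- The greedy destinations of the sensors `a, a + 1, …`, shifted by one place. -/
noncomputable def greedy (r : ℝ) (x : ℕ → ℝ) (a : ℕ) (μ : ℝ) : ℕ → ℝ
  -- A virtual sensor whose interval ends at `0`.
  | 0 => -r
  | k + 1 => min (greedy r x a μ k + 2 * r) (x (a + k) + μ)

/-- The sensors of the block move to their greedy destinations, the others stay. -/
noncomputable def plan (r : ℝ) (x : ℕ → ℝ) (a c : ℕ) (μ : ℝ) (i : ℕ) : ℝ :=
  if a ≤ i ∧ i < c then greedy r x a μ (i - a + 1) else x i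

/-- The greedy position is never too far left: continuing with spacing `2 * r`, the last sensor
would still reach `L`, and each sensor `j` would still be at `x j - μ` or beyond. `first` and `hlen`
start the induction; when the minimum is `x (a + k) + μ`, `last` and `pair` carry it on. -/
theorem Feasible.le_greedy {L r μ : ℝ} {x : ℕ → ℝ} {a c : ℕ} (h : Feasible L r x a c μ)
    (hlen : L ≤ 2 * r * (c - a : ℝ)) (k : ℕ) (hk : a + k ≤ c) :
    L + r - 2 * r * (c - a - k + 1 : ℝ) ≤ greedy r x a μ k ∧
      ∀ j, a + k ≤ j + 1 → a ≤ j → j < c → x j - μ - 2 * r * (j - a - k + 1) ≤ greedy r x a μ k := by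
  induction k with
  | zero =>
    simp only [greedy, Nat.cast_zero, sub_zero]
    refine ⟨by linarith, fun j _ hj hjc => ?_⟩
    linarith [h.first j hj hjc]
  | succ k ih =>
    obtain ⟨h1, h2⟩ := ih (by omega)
    simp only [greedy]
    refine ⟨le_min ?_ ?_, fun j hj hja hjc => le_min ?_ ?_⟩
    · push_cast; linarith
    · have := h.last (a + k) (by omega) (by omega)
      push_cast at this ⊢; linarith
    · have := h2 j (by omega) hja hjc
      push_cast; linarith
    · have := h.pair (a + k) j (by omega) (by omega) hjc
      push_cast at this ⊢; linarith

theorem Feasible.abs_sub_plan_le {L r μ : ℝ} {x : ℕ → ℝ} {a c : ℕ} (h : Feasible L r x a c μ)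
    (hlen : L ≤ 2 * r * (c - a : ℝ)) (hac : a < c) (i : ℕ) : |x i - plan r x a c μ i| ≤ μ := by
  -- The diagonal case of `pair`; it serves the sensors that stay.
  have hμ : 0 ≤ μ := by linarith [h.pair a a le_rfl le_rfl hac]
  rw [plan]
  split_ifs with hi
  · obtain ⟨k, rfl⟩ := Nat.exists_eq_add_of_le hi.1
    rw [Nat.add_sub_cancel_left, abs_le]
    have h1 := (h.le_greedy hlen (k + 1) (by omega)).2 (a + k) (by omega) (by omega) hi.2
    have h2 : greedy r x a μ (k + 1) ≤ x (a + k) + μ := min_le_right _ _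
    push_cast at h1
    constructor <;> linarith
  · simpa using hμ

/-- The first sensor of the block whose right end reaches `p` covers `p`: its left end is at most
the right end of its predecessor, which lies before `p`, or at most `0` if there is no predecessor.
-/
theorem Feasible.exists_mem_plan {L r μ : ℝ} {x : ℕ → ℝ} {a c : ℕ} (h : Feasible L r x a c μ)
    (hlen : L ≤ 2 * r * (c - a : ℝ)) (hac : a < c) {p : ℝ} (hp : p ∈ Set.Icc 0 L) :
    ∃ i < c, p ∈ Set.Icc (plan r x a c μ i - r) (plan r x a c μ i + r) := by
  have hex : ∃ k, p ≤ greedy r x a μ (k + 1) + r := by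
    refine ⟨c - a - 1, ?_⟩
    have := (h.le_greedy hlen (c - a - 1 + 1) (by omega)).1
    rw [Nat.sub_add_cancel (by omega : 1 ≤ c - a)] at this ⊢
    rw [Nat.cast_sub hac.le] at this
    linarith [hp.2]
  classical
  obtain ⟨k, hk, hmin⟩ : ∃ k, p ≤ greedy r x a μ (k + 1) + r ∧
      ∀ l < k, ¬ p ≤ greedy r x a μ (l + 1) + r :=
    ⟨Nat.find hex, Nat.find_spec hex, fun l hl => Nat.find_min hex hl⟩
  have hkc : a + k < c := by
    by_contra! hck
    have := (h.le_greedy hlen (c - a - 1 + 1) (by omega)).1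
    refine hmin (c - a - 1) (by omega) ?_
    rw [Nat.sub_add_cancel (by omega : 1 ≤ c - a)] at this ⊢
    rw [Nat.cast_sub hac.le] at this
    linarith [hp.2]
  refine ⟨a + k, hkc, ?_⟩
  rw [plan, if_pos ⟨by omega, hkc⟩, Nat.add_sub_cancel_left]
  refine ⟨?_, hk⟩
  have h2 : greedy r x a μ (k + 1) ≤ greedy r x a μ k + 2 * r := min_le_left _ _
  cases k with
  | zero => simp only [greedy] at h2 ⊢; linarith [hp.1]
  | succ k => linarith [not_le.1 (hmin k (by omega))]

/-! ## Growing the block of used sensors -/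

/-- The maximum `mx`, the minimum `mn` and the greatest rise `M` of `u` on `a, …, c - 1`. -/
structure Extremes (u : ℕ → ℝ) (a c : ℕ) (mx mn M : ℝ) : Prop where
  max_le : ∀ v, mx ≤ v ↔ ∀ j, a ≤ j → j < c → u j ≤ v
  le_min : ∀ v, v ≤ mn ↔ ∀ j, a ≤ j → j < c → v ≤ u j
  rise_le : ∀ v, M ≤ v ↔ ∀ i j, a ≤ i → i ≤ j → j < c → u j - u i ≤ v

theorem Extremes.single (u : ℕ → ℝ) (a : ℕ) : Extremes u a (a + 1) (u a) (u a) 0 := by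
  refine ⟨fun v => ⟨fun h j h1 h2 => ?_, fun h => h a le_rfl (Nat.lt_succ_self a)⟩,
    fun v => ⟨fun h j h1 h2 => ?_, fun h => h a le_rfl (Nat.lt_succ_self a)⟩,
    fun v => ⟨fun h i j h1 h2 h3 => ?_, fun h => ?_⟩⟩
  · obtain rfl : j = a := by omega
    exact h
  · obtain rfl : j = a := by omega
    exact h
  · obtain rfl : j = a := by omega
    obtain rfl : i = j := by omega
    simpa using h
  · simpa using h a a le_rfl le_rfl (Nat.lt_succ_self a)

/-- Rises that involve the new sensor start there, so the greatest of them is the new maximum minus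
`u a`. -/
theorem Extremes.left {u : ℕ → ℝ} {a c : ℕ} {mx mn M : ℝ} (h : Extremes u (a + 1) c mx mn M)
    (hac : a < c) :
    Extremes u a c (max mx (u a)) (min mn (u a)) (max M (max mx (u a) - u a)) := by
  have key : ∀ v, max mx (u a) ≤ v ↔ ∀ j, a ≤ j → j < c → u j ≤ v := by
    intro v
    rw [max_le_iff, h.max_le]
    refine ⟨fun ⟨h1, h2⟩ j h3 h4 => ?_, fun h1 => ⟨fun j h2 => h1 j (by omega), h1 a le_rfl hac⟩⟩
    rcases h3.eq_or_lt with rfl | h5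
    · exact h2
    · exact h1 j h5 h4
  refine ⟨key, fun v => ?_, fun v => ?_⟩
  · rw [le_min_iff, h.le_min]
    refine ⟨fun ⟨h1, h2⟩ j h3 h4 => ?_, fun h1 => ⟨fun j h2 => h1 j (by omega), h1 a le_rfl hac⟩⟩
    rcases h3.eq_or_lt with rfl | h5
    · exact h2
    · exact h1 j h5 h4
  · rw [max_le_iff, h.rise_le, sub_le_iff_le_add, key]
    refine ⟨fun ⟨h1, h2⟩ i j h3 h4 h5 => ?_, fun h1 => ⟨fun i j h2 => h1 i j (by omega),
      fun j h2 h3 => sub_le_iff_le_add.1 (h1 a j le_rfl h2 h3)⟩⟩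
    rcases h3.eq_or_lt with rfl | h6
    · exact sub_le_iff_le_add.2 (h2 j h4 h5)
    · exact h1 i j h6 h4 h5

/-- Rises that involve the new sensor end there, so the greatest of them is `u c` minus the new
minimum. -/
theorem Extremes.right {u : ℕ → ℝ} {a c : ℕ} {mx mn M : ℝ} (h : Extremes u a c mx mn M)
    (hac : a ≤ c) :
    Extremes u a (c + 1) (max mx (u c)) (min mn (u c)) (max M (u c - min mn (u c))) := by
  have key : ∀ v, v ≤ min mn (u c) ↔ ∀ j, a ≤ j → j < c + 1 → v ≤ u j := by
    intro v
    rw [le_min_iff, h.le_min]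
    refine ⟨fun ⟨h1, h2⟩ j h3 h4 => ?_,
      fun h1 => ⟨fun j h2 h3 => h1 j h2 (by omega), h1 c hac (by omega)⟩⟩
    rcases (Nat.lt_succ_iff.1 h4).eq_or_lt with rfl | h5
    · exact h2
    · exact h1 j h3 h5
  refine ⟨fun v => ?_, key, fun v => ?_⟩
  · rw [max_le_iff, h.max_le]
    refine ⟨fun ⟨h1, h2⟩ j h3 h4 => ?_,
      fun h1 => ⟨fun j h2 h3 => h1 j h2 (by omega), h1 c hac (by omega)⟩⟩
    rcases (Nat.lt_succ_iff.1 h4).eq_or_lt with rfl | h5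
    · exact h2
    · exact h1 j h3 h5
  · rw [max_le_iff, h.rise_le, sub_le_comm, key]
    refine ⟨fun ⟨h1, h2⟩ i j h3 h4 h5 => ?_,
      fun h1 => ⟨fun i j h2 h3 h4 => h1 i j h2 h3 (by omega),
        fun j h2 h3 => sub_le_comm.1 (h1 j c h2 (by omega) (by omega))⟩⟩
    rcases (Nat.lt_succ_iff.1 h5).eq_or_lt with rfl | h6
    · exact sub_le_comm.1 (h2 i h3 (by omega))
    · exact h1 i j h3 h4 h6

/-- The least `μ` with `Feasible L r x a c μ`, in terms of the extremes. -/
noncomputable def blockValue (L r : ℝ) (a c : ℕ) (mx mn M : ℝ) : ℝ :=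
  max (max (M * (1 / 2)) (mx + 2 * r * a - r)) (L + r - 2 * r * c - mn)

theorem Extremes.blockValue_le_iff {L r : ℝ} {x : ℕ → ℝ} {a c : ℕ} {mx mn M : ℝ}
    (h : Extremes (fun i => x i - 2 * r * i) a c mx mn M) (μ : ℝ) :
    blockValue L r a c mx mn M ≤ μ ↔ Feasible L r x a c μ := by
  have e1 : M * (1 / 2) ≤ μ ↔ M ≤ 2 * μ := by constructor <;> intro h <;> linarith
  have e2 : mx + 2 * r * a - r ≤ μ ↔ mx ≤ μ + r - 2 * r * a := by
    constructor <;> intro h <;> linarith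
  have e3 : L + r - 2 * r * c - mn ≤ μ ↔ L + r - 2 * r * c - μ ≤ mn := sub_le_comm
  rw [blockValue, max_le_iff, max_le_iff, e1, e2, e3, h.rise_le, h.max_le, h.le_min]
  constructor
  · rintro ⟨⟨h1, h2⟩, h3⟩
    exact ⟨fun j hj hj' => by linarith [h2 j hj hj'], h1, fun i hi hi' => by linarith [h3 i hi hi']⟩
  · rintro ⟨h1, h2, h3⟩
    exact ⟨⟨h2, fun j hj hj' => by linarith [h1 j hj hj']⟩,
      fun i hi hi' => by linarith [h3 i hi hi']⟩

/-! ### Blocks that can touch the barrier in every solution -/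

/-- The block of sensors `a, …, c - 1`, with its extremes and its value, consists of sensors that
can reach the barrier in each solution. -/
structure Block (n : ℕ) (L r : ℝ) (x : ℕ → ℝ) (a c : ℕ) (mx mn M v : ℝ) : Prop where
  le : a ≤ c
  le_n : c ≤ n
  left_lt : ∀ i < a, x i < -r
  right_ge : ∀ i, c ≤ i → i < n → -r ≤ x i
  reach : ∀ μ, Achievable n L r x μ → ∀ i, a ≤ i → i < c → -r - x i ≤ μ ∧ x i - L - r ≤ μ
  -- An empty block has no extremes; the stored numbers are then arbitrary.
  extremes : a < c → Extremes (fun i => x i - 2 * r * i) a c mx mn M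
  value : a < c → v = blockValue L r a c mx mn M

/-- No further sensor can improve the block. -/
def Final (n : ℕ) (L r : ℝ) (x : ℕ → ℝ) (a c : ℕ) (v : ℝ) : Prop :=
  L ≤ 2 * r * (c - a : ℝ) ∧ (1 ≤ a → v ≤ -r - x (a - 1)) ∧ (c + 1 ≤ n → v ≤ x c - L - r)

section Block

variable {n : ℕ} {L r : ℝ} {x : ℕ → ℝ} {a c : ℕ} {mx mn M v : ℝ}

theorem Block.le_iff (h : Block n L r x a c mx mn M v) (hac : a < c) (μ : ℝ) :
    v ≤ μ ↔ Feasible L r x a c μ := by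
  rw [h.value hac, (h.extremes hac).blockValue_le_iff]

theorem lt_of_length (hL : 0 < L) (hr : 0 < r) (h : L ≤ 2 * r * (c - a : ℝ)) : a < c := by
  by_contra! hca
  have : (c : ℝ) ≤ a := by exact_mod_cast hca
  have : 2 * r * (c - a : ℝ) ≤ 0 := mul_nonpos_of_nonneg_of_nonpos (by linarith) (by linarith)
  linarith

/-- A solution that moves less than the sensors next to the block need is a solution of the block. -/
theorem Block.of_lt (h : Block n L r x a c mx mn M v) (hL : 0 < L) (hr : 0 < r)
    (hx : ∀ i j, i ≤ j → j < n → x i ≤ x j) {μ : ℝ} (hμ : Achievable n L r x μ)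
    (hl : 1 ≤ a → μ < -r - x (a - 1)) (hc : c + 1 ≤ n → μ < x c - L - r) :
    L ≤ 2 * r * (c - a : ℝ) ∧ v ≤ μ := by
  have key := hμ.feasible hL hr hx h.le h.le_n
    (fun i hi => by
      have := hx i (a - 1) (by omega) (by have := h.le; have := h.le_n; omega)
      linarith [hl (by omega)])
    (fun i hi hin => by
      have := hx c i hi hin
      linarith [hc (by omega)])
    (h.reach μ hμ)
  exact ⟨key.1, (h.le_iff (lt_of_length hL hr key.1) μ).2 key.2⟩

/-- A solution cheaper than `τ` could use no sensor outside the block, so the block would be long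
enough with a value below `τ`, hence final. -/
theorem Block.le_of_not_final (h : Block n L r x a c mx mn M v) (hL : 0 < L) (hr : 0 < r)
    (hx : ∀ i j, i ≤ j → j < n → x i ≤ x j) (hf : ¬ Final n L r x a c v) {τ : ℝ}
    (hl : 1 ≤ a → τ ≤ -r - x (a - 1)) (hc : c + 1 ≤ n → τ ≤ x c - L - r)
    {μ : ℝ} (hμ : Achievable n L r x μ) : τ ≤ μ := by
  by_contra! hlt
  obtain ⟨h1, h2⟩ := h.of_lt hL hr hx hμ (fun ha => hlt.trans_le (hl ha))
    (fun ha => hlt.trans_le (hc ha))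
  exact hf ⟨h1, fun ha => by linarith [hl ha], fun ha => by linarith [hc ha]⟩

theorem Block.le_of_final (h : Block n L r x a c mx mn M v) (hL : 0 < L) (hr : 0 < r)
    (hx : ∀ i j, i ≤ j → j < n → x i ≤ x j) (hf : Final n L r x a c v)
    {μ : ℝ} (hμ : Achievable n L r x μ) : v ≤ μ := by
  by_contra! hlt
  exact hlt.not_ge (h.of_lt hL hr hx hμ (fun ha => hlt.trans_le (hf.2.1 ha))
    (fun ha => hlt.trans_le (hf.2.2 ha))).2

/-- The left neighbour has the smaller need `-r - x (a - 1)`, which bounds every solution from below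
because the block is not final. -/
theorem Block.left (h : Block n L r x a c mx mn M v) (hL : 0 < L) (hr : 0 < r)
    (hx : ∀ i j, i ≤ j → j < n → x i ≤ x j) (hf : ¬ Final n L r x a c v)
    (ha : 1 ≤ a) (hc : c + 1 ≤ n → -r - x (a - 1) ≤ x c - L - r) {mx' mn' M' v' : ℝ}
    (hext : Extremes (fun i => x i - 2 * r * i) (a - 1) c mx' mn' M')
    (hv : v' = blockValue L r (a - 1 : ℕ) c mx' mn' M') :
    Block n L r x (a - 1) c mx' mn' M' v' := by
  refine ⟨by have := h.le; omega, h.le_n, fun i hi => h.left_lt i (by omega), h.right_ge,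
    fun μ hμ i hi hic => ?_, fun _ => hext, fun _ => hv⟩
  rcases eq_or_lt_of_le hi with rfl | hlt
  · have := h.le_of_not_final hL hr hx hf (τ := -r - x (a - 1)) (fun _ => le_rfl) hc hμ
    refine ⟨this, ?_⟩
    linarith [h.left_lt (a - 1) (by omega)]
  · exact h.reach μ hμ i (by omega) hic

theorem Block.right (h : Block n L r x a c mx mn M v) (hL : 0 < L) (hr : 0 < r)
    (hx : ∀ i j, i ≤ j → j < n → x i ≤ x j) (hf : ¬ Final n L r x a c v)
    (hc : c + 1 ≤ n) (ha : 1 ≤ a → x c - L - r ≤ -r - x (a - 1)) {mx' mn' M' v' : ℝ}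
    (hext : Extremes (fun i => x i - 2 * r * i) a (c + 1) mx' mn' M')
    (hv : v' = blockValue L r a (c + 1 : ℕ) mx' mn' M') :
    Block n L r x a (c + 1) mx' mn' M' v' := by
  refine ⟨by have := h.le; omega, hc, h.left_lt, fun i hi => h.right_ge i (by omega),
    fun μ hμ i hi hic => ?_, fun _ => hext, fun _ => hv⟩
  rcases eq_or_lt_of_le (Nat.lt_succ_iff.1 hic) with rfl | hlt
  · have := h.le_of_not_final hL hr hx hf (τ := x i - L - r) ha (fun _ => le_rfl) hμ
    obtain ⟨y, -, hy⟩ := hμ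
    -- Since `μ ≥ 0` and the sensor is not left of `-r`, it only has to reach the barrier from the
    -- right.
    have h0 := (abs_nonneg _).trans (hy ⟨i, hc⟩)
    exact ⟨by linarith [h.right_ge i le_rfl hc], this⟩
  · exact h.reach μ hμ i hi hlt

end Block

/-! ## The program

Natural variables: `0` the number of sensors, `1` and `2` the ends of the block, `3` a counter.
Real variables: `0` the length of the barrier, `1` the value of the block, `2` the range,
`3`, `4`, `5` the extremes of the block, `6` and `7` auxiliary. -/

namespace Uniform

/-- `2 * r * e`. -/
def offset (e : NatExp) : RealExp := .mul (.mul (.lit 2) (.var 2)) (.ofNatExp e)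

/-- What the sensor to the left of the block has to move to reach the barrier. -/
def leftNeed : RealExp :=
  .sub (.sub (.lit 0) (.var 2)) (.get 0 (.sub (.var 1) (.lit 1)))

/-- What the sensor to the right of the block has to move to reach the barrier. -/
def rightNeed : RealExp := .sub (.sub (.get 0 (.var 2)) (.var 0)) (.var 2)

/-- There is a sensor to the left of the block. -/
def hasLeft : Test := .natLE (.lit 1) (.var 1)

/-- There is a sensor to the right of the block. -/
def hasRight : Test := .natLE (.add (.var 2) (.lit 1)) (.var 0)

/-- The block is not final. -/
def unfinished : Test :=
  .not (.and (.realLE (.var 0)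
      (.mul (.mul (.lit 2) (.var 2)) (.sub (.ofNatExp (.var 2)) (.ofNatExp (.var 1)))))
    (.and (.not (.and hasLeft (.not (.realLE (.var 1) leftNeed))))
      (.not (.and hasRight (.not (.realLE (.var 1) rightNeed))))))

/-- The next sensor comes from the left. -/
def goLeft : Test := .and hasLeft (.not (.and hasRight (.not (.realLE leftNeed rightNeed))))

/-- The extremes of a block with one sensor. -/
def startBlock : Prog :=
  .seq (.setReal 3 (.var 6)) (.seq (.setReal 4 (.var 6)) (.setReal 5 (.lit 0)))

/-- Update of the extremes, where `e` is the greatest rise that involves the new sensor. -/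
def extendBlock (e : RealExp) : Prog :=
  -- The ends are already updated, so the test detects that the new sensor is alone.
  .ite (.natLE (.var 2) (.add (.var 1) (.lit 1))) startBlock
    -- The order matters: `e` has to read the new maximum or minimum.
    (.seq (.raise 3 (.var 6)) (.seq (.lower 4 (.var 6)) (.raise 5 e)))

/-- Adds the sensor to the left of the block. -/
def addLeft : Prog :=
  .seq (.setNat 1 (.sub (.var 1) (.lit 1)))
    (.seq (.setReal 6 (.sub (.get 0 (.var 1)) (offset (.var 1))))
      (extendBlock (.sub (.var 3) (.var 6))))

/-- Adds the sensor to the right of the block. -/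
def addRight : Prog :=
  .seq (.setReal 6 (.sub (.get 0 (.var 2)) (offset (.var 2))))
    (.seq (.setNat 2 (.add (.var 2) (.lit 1)))
      (extendBlock (.sub (.var 6) (.var 4))))

/-- Computes the value of the block. -/
def setValue : Prog :=
  .seq (.setReal 1 (.mul (.var 5) (.lit (1 / 2))))
    (.seq (.raise 1 (.sub (.add (.var 3) (offset (.var 1))) (.var 2)))
      (.raise 1 (.sub (.sub (.add (.var 0) (.var 2)) (offset (.var 2))) (.var 4))))

def growStep : Prog := .seq (.ite goLeft addLeft addRight) setValue

def readRange : Prog := .setReal 2 (.get 1 (.lit 0))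

def scanTest : Test :=
  .and hasRight (.not (.realLE (.sub (.lit 0) (.var 2)) (.get 0 (.var 2))))

def scanStep : Prog := .setNat 2 (.add (.var 2) (.lit 1))

def emptyBlock : Prog := .setNat 1 (.var 2)

def startPlan : Prog := .setReal 7 (.sub (.lit 0) (.var 2))

def planTest : Test := .natLE (.add (.var 3) (.lit 1)) (.var 0)

/-- Computes the destination of the next sensor. -/
def planStep : Prog :=
  .seq
    (.ite (.and (.natLE (.var 1) (.var 3)) (.natLE (.add (.var 3) (.lit 1)) (.var 2)))
      (.seq (.setReal 7 (.add (.var 7) (.mul (.lit 2) (.var 2))))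
        (.seq (.lower 7 (.add (.get 0 (.var 3)) (.var 1))) (.putReal 2 (.var 3) (.var 7))))
      (.putReal 2 (.var 3) (.get 0 (.var 3))))
    (.setNat 3 (.add (.var 3) (.lit 1)))

def program : Prog :=
  .seq readRange (.seq (.loop scanTest scanStep) (.seq emptyBlock
    (.seq (.loop unfinished growStep) (.seq startPlan (.loop planTest planStep)))))

/-- The number of steps of the program is at most `slope * n + const`. -/
def slope : ℕ :=
  (scanTest.cost + 1 + scanStep.bound) + (unfinished.cost + 1 + growStep.bound) +
    (planTest.cost + 1 + planStep.bound)

/-- See `slope`. -/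
def const : ℕ :=
  readRange.bound + (scanTest.cost + 1) + emptyBlock.bound + (unfinished.cost + 1) +
    startPlan.bound + (planTest.cost + 1)

/-! ## Correctness of the program -/

/-- The memory holds the number of sensors, the length of the barrier, the range and the positions.
-/
structure Holds (n : ℕ) (L r : ℝ) (x : ℕ → ℝ) (s : Store) : Prop where
  num : s.natVar 0 = n
  len : s.realVar 0 = L
  range : s.realVar 2 = r
  pos : s.realArr 0 = x

section

variable {n : ℕ} {L r : ℝ} {x : ℕ → ℝ}

/-- The memory holds a block. -/
structure HoldsBlock (n : ℕ) (L r : ℝ) (x : ℕ → ℝ) (s : Store) : Prop extends Holds n L r x s where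
  block : Block n L r x (s.natVar 1) (s.natVar 2) (s.realVar 3) (s.realVar 4) (s.realVar 5)
    (s.realVar 1)
  counter : s.natVar 3 = 0

theorem holds_unfinished {s : Store} (h : Holds n L r x s) :
    unfinished.holds s ↔ ¬ Final n L r x (s.natVar 1) (s.natVar 2) (s.realVar 1) := by
  simp [unfinished, Test.holds, hasLeft, hasRight, leftNeed, rightNeed, RealExp.eval, NatExp.eval,
    Final, h.num, h.len, h.range, h.pos]

theorem holds_goLeft {s : Store} (h : Holds n L r x s) :
    goLeft.holds s ↔ 1 ≤ s.natVar 1 ∧ (s.natVar 2 + 1 ≤ n →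
      -r - x (s.natVar 1 - 1) ≤ x (s.natVar 2) - L - r) := by
  simp [goLeft, Test.holds, hasLeft, hasRight, leftNeed, rightNeed, RealExp.eval, NatExp.eval,
    h.num, h.len, h.range, h.pos]

theorem loopFree_growStep : growStep.LoopFree := by
  simp [growStep, addLeft, addRight, extendBlock, startBlock, setValue, Prog.LoopFree]

theorem loopFree_planStep : planStep.LoopFree := by
  simp [planStep, Prog.LoopFree]

theorem addLeft_spec {s : Store} (h : HoldsBlock n L r x s) (ha : 1 ≤ s.natVar 1) :
    Holds n L r x (addLeft.run s) ∧ (addLeft.run s).natVar 1 = s.natVar 1 - 1 ∧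
      (addLeft.run s).natVar 2 = s.natVar 2 ∧ (addLeft.run s).natVar 3 = 0 ∧
      Extremes (fun i => x i - 2 * r * i) (s.natVar 1 - 1) (s.natVar 2)
        ((addLeft.run s).realVar 3) ((addLeft.run s).realVar 4) ((addLeft.run s).realVar 5) := by
  have hle := h.block.le
  -- Writing the left end as `a + 1` removes the truncated subtraction.
  obtain ⟨a, ha'⟩ := Nat.exists_eq_add_of_le' ha
  by_cases hc : s.natVar 2 ≤ s.natVar 1
  · have hca : s.natVar 2 = a + 1 := by omega
    refine ⟨⟨?_, ?_, ?_, ?_⟩, ?_, ?_, ?_, ?_⟩ <;>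
      simp [addLeft, extendBlock, startBlock, Prog.run, Test.holds, RealExp.eval, NatExp.eval,
        offset, Store.setNat, Store.setReal, h.num, h.len, h.range, h.pos, h.counter,
        hca, ha']
    exact Extremes.single (fun i => x i - 2 * r * i) a
  · have hca : ¬ s.natVar 2 ≤ a + 1 := by omega
    refine ⟨⟨?_, ?_, ?_, ?_⟩, ?_, ?_, ?_, ?_⟩ <;>
      simp [addLeft, extendBlock, startBlock, Prog.run, Test.holds, RealExp.eval, NatExp.eval,
        offset, Store.setNat, Store.setReal, h.num, h.len, h.range, h.pos, h.counter,
        hca, ha']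
    have he := h.block.extremes (by omega)
    rw [ha'] at he
    exact he.left (by omega)

theorem addRight_spec {s : Store} (h : HoldsBlock n L r x s) :
    Holds n L r x (addRight.run s) ∧ (addRight.run s).natVar 1 = s.natVar 1 ∧
      (addRight.run s).natVar 2 = s.natVar 2 + 1 ∧ (addRight.run s).natVar 3 = 0 ∧
      Extremes (fun i => x i - 2 * r * i) (s.natVar 1) (s.natVar 2 + 1)
        ((addRight.run s).realVar 3) ((addRight.run s).realVar 4) ((addRight.run s).realVar 5) := by
  have hle := h.block.le
  by_cases hc : s.natVar 2 ≤ s.natVar 1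
  · have hca : s.natVar 2 = s.natVar 1 := by omega
    refine ⟨⟨?_, ?_, ?_, ?_⟩, ?_, ?_, ?_, ?_⟩ <;>
      simp [addRight, extendBlock, startBlock, Prog.run, Test.holds, RealExp.eval, NatExp.eval,
        offset, Store.setNat, Store.setReal, h.num, h.len, h.range, h.pos, h.counter,
        hca]
    exact Extremes.single (fun i => x i - 2 * r * i) (s.natVar 1)
  · refine ⟨⟨?_, ?_, ?_, ?_⟩, ?_, ?_, ?_, ?_⟩ <;>
      simp [addRight, extendBlock, startBlock, Prog.run, Test.holds, RealExp.eval, NatExp.eval,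
        offset, Store.setNat, Store.setReal, h.num, h.len, h.range, h.pos, h.counter,
        hc]
    exact (h.block.extremes (by omega)).right hle

theorem setValue_spec {s : Store} (h : Holds n L r x s) :
    Holds n L r x (setValue.run s) ∧ (setValue.run s).natVar = s.natVar ∧
      (setValue.run s).realVar 3 = s.realVar 3 ∧ (setValue.run s).realVar 4 = s.realVar 4 ∧
      (setValue.run s).realVar 5 = s.realVar 5 ∧ (setValue.run s).realVar 1 =
        blockValue L r (s.natVar 1) (s.natVar 2) (s.realVar 3) (s.realVar 4) (s.realVar 5) := by
  refine ⟨⟨?_, ?_, ?_, ?_⟩, ?_, ?_, ?_, ?_, ?_⟩ <;>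
    simp [setValue, Prog.run, RealExp.eval, NatExp.eval, offset, Store.setReal, blockValue, h.num, h.len, h.range, h.pos]

theorem growStep_spec (hL : 0 < L) (hr : 0 < r) (hx : ∀ i j, i ≤ j → j < n → x i ≤ x j)
    (hlen : L ≤ 2 * r * n) {s : Store} (h : HoldsBlock n L r x s) (hs : unfinished.holds s) :
    HoldsBlock n L r x (growStep.run s) ∧
      (growStep.run s).natVar 1 + (n - (growStep.run s).natVar 2) <
        s.natVar 1 + (n - s.natVar 2) := by
  have hf := (holds_unfinished h.toHolds).1 hs
  by_cases hg : goLeft.holds s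
  · obtain ⟨ha, hc⟩ := (holds_goLeft h.toHolds).1 hg
    have hrun : growStep.run s = setValue.run (addLeft.run s) := by
      simp [growStep, Prog.run, hg]
    obtain ⟨h1, h2, h3, h4, h5⟩ := addLeft_spec h ha
    obtain ⟨k1, k2, k3, k4, k5, k6⟩ := setValue_spec h1
    rw [hrun]
    refine ⟨⟨k1, ?_, by rw [k2, h4]⟩, ?_⟩
    · rw [k6, k2, k3, k4, k5, h2, h3]
      exact h.block.left hL hr hx hf ha hc h5 rfl
    · rw [k2, h2, h3]
      omega
  · have hg' := (not_congr (holds_goLeft h.toHolds)).1 hg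
    have hrun : growStep.run s = setValue.run (addRight.run s) := by
      simp [growStep, Prog.run, hg]
    -- Without a right neighbour, not going left means that there is no left one either. The block
    -- then contains all sensors and is final by `hlen`.
    have hcn : s.natVar 2 + 1 ≤ n := by
      by_contra! hcn
      have ha : ¬ 1 ≤ s.natVar 1 := fun ha => hg' ⟨ha, fun hc => by omega⟩
      have h1 : s.natVar 1 = 0 := by omega
      have h2 : s.natVar 2 = n := by have := h.block.le_n; omega
      refine hf ⟨?_, fun h => (ha h).elim, fun h => by omega⟩
      rw [h1, h2]
      simpa using hlen
    obtain ⟨h1, h2, h3, h4, h5⟩ := addRight_spec h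
    obtain ⟨k1, k2, k3, k4, k5, k6⟩ := setValue_spec h1
    rw [hrun]
    refine ⟨⟨k1, ?_, by rw [k2, h4]⟩, ?_⟩
    · rw [k6, k2, k3, k4, k5, h2, h3]
      refine h.block.right hL hr hx hf hcn (fun ha => ?_) h5 rfl
      by_contra! hlt
      exact hg' ⟨ha, fun _ => hlt.le⟩
    · rw [k2, h2, h3]
      omega

/-- The memory holds a block and the destinations of the sensors that precede the counter. -/
structure HoldsPlan (n : ℕ) (L r : ℝ) (x : ℕ → ℝ) (a c : ℕ) (v : ℝ) (s : Store) : Prop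
    extends Holds n L r x s where
  left : s.natVar 1 = a
  right : s.natVar 2 = c
  value : s.realVar 1 = v
  -- The truncated difference is `0` before the block and stays at `c - a` after it.
  front : s.realVar 7 = greedy r x a v (min (s.natVar 3) c - a)
  done : ∀ i < s.natVar 3, s.realArr 2 i = plan r x a c v i

theorem planStep_spec {a c : ℕ} {v : ℝ} {s : Store} (h : HoldsPlan n L r x a c v s)
    (hs : planTest.holds s) :
    HoldsPlan n L r x a c v (planStep.run s) ∧
      n - (planStep.run s).natVar 3 < n - s.natVar 3 := by
  have hn : s.natVar 3 + 1 ≤ n := by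
    simpa [planTest, Test.holds, NatExp.eval, h.num] using hs
  obtain ⟨i, hi⟩ : ∃ i, s.natVar 3 = i := ⟨_, rfl⟩
  have hfront := h.front
  have hdone := h.done
  rw [hi] at hfront hdone hn
  by_cases hb : a ≤ i ∧ i < c
  · have hb' : i + 1 ≤ c := hb.2
    have e1 : min i c - a = i - a := by omega
    have e2 : i + 1 - a = i - a + 1 := by omega
    rw [e1] at hfront
    have e3 : a + (i - a) = i := by omega
    refine ⟨⟨⟨?_, ?_, ?_, ?_⟩, ?_, ?_, ?_, ?_, ?_⟩, ?_⟩ <;>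
      simp [planStep, Prog.run, Test.holds, RealExp.eval, NatExp.eval, Store.setNat,
        Store.setReal, Store.putReal, Function.update_apply, h.num, h.len, h.range, h.pos, h.left, h.right,
        h.value, hi, hb.1, hb', hfront]
    · rw [e2, greedy, e3]
    · intro j hj
      split_ifs with hji
      · rw [hji, plan, if_pos hb, greedy, e3]
      · exact hdone j (by omega)
    · omega
  · have hb' : ¬ (a ≤ i ∧ i + 1 ≤ c) := hb
    have e2 : min (i + 1) c - a = min i c - a := by omega
    refine ⟨⟨⟨?_, ?_, ?_, ?_⟩, ?_, ?_, ?_, ?_, ?_⟩, ?_⟩ <;>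
      simp [planStep, Prog.run, Test.holds, RealExp.eval, NatExp.eval, Store.setNat,
        Store.putReal, Function.update_apply, h.num, h.len, h.range, h.pos, h.left, h.right,
        h.value, hi, hb, hfront, -not_and]
    · rw [e2]
    · intro j hj
      split_ifs with hji
      · rw [hji, plan, if_neg hb]
      · exact hdone j (by omega)
    · omega

/-- What the scan for the first sensor that reaches the barrier from the left maintains. -/
structure HoldsScan (n : ℕ) (L r : ℝ) (x : ℕ → ℝ) (s : Store) : Prop extends Holds n L r x s where
  le_n : s.natVar 2 ≤ n
  left_lt : ∀ i < s.natVar 2, x i < -r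
  counter : s.natVar 3 = 0

theorem scanStep_spec {s : Store} (h : HoldsScan n L r x s) (hs : scanTest.holds s) :
    HoldsScan n L r x (scanStep.run s) ∧
      n - (scanStep.run s).natVar 2 < n - s.natVar 2 := by
  obtain ⟨h1, h2⟩ : s.natVar 2 + 1 ≤ n ∧ x (s.natVar 2) < -r := by
    simpa [scanTest, hasRight, Test.holds, NatExp.eval, RealExp.eval, h.num, h.range, h.pos] using hs
  refine ⟨⟨⟨?_, ?_, ?_, ?_⟩, ?_, ?_, ?_⟩, ?_⟩ <;>
    simp [scanStep, Prog.run, NatExp.eval, Store.setNat, h.num, h.len, h.range, h.pos,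
      h.counter]
  · omega
  · intro i hi
    rcases hi.eq_or_lt with rfl | hlt
    · exact h2
    · exact h.left_lt i hlt
  · omega

theorem holdsBlock_emptyBlock (hx : ∀ i j, i ≤ j → j < n → x i ≤ x j) {s : Store}
    (h : HoldsScan n L r x s) (hs : ¬ scanTest.holds s) :
    HoldsBlock n L r x (emptyBlock.run s) := by
  have h1 : s.natVar 2 + 1 ≤ n → -r ≤ x (s.natVar 2) := by
    simpa [scanTest, hasRight, Test.holds, NatExp.eval, RealExp.eval, h.num, h.range, h.pos] using hs
  refine ⟨⟨?_, ?_, ?_, ?_⟩, ?_, ?_⟩ <;>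
    simp [emptyBlock, Prog.run, NatExp.eval, Store.setNat, h.num, h.len, h.range,
      h.pos, h.counter]
  refine ⟨le_rfl, h.le_n, h.left_lt, fun i hi hin => ?_, fun μ _ i h1 h2 => by omega,
    fun h => by omega, fun h => by omega⟩
  exact (h1 (by omega)).trans (hx _ _ hi hin)

/-- The program computes an optimal plan. -/
theorem exists_exec_program (hL : 0 < L) (hr : 0 < r) (hx : ∀ i j, i ≤ j → j < n → x i ≤ x j)
    (hlen : L ≤ 2 * r * n) {s : Store} (hn : s.natVar 0 = n) (h0 : s.realVar 0 = L)
    (hr' : s.realArr 1 0 = r) (hx' : s.realArr 0 = x) (h2 : s.natVar 2 = 0)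
    (h3 : s.natVar 3 = 0) :
    ∃ t s' a c, Exec program s t s' ∧ t ≤ slope * n + const ∧
      c ≤ n ∧ a < c ∧ L ≤ 2 * r * (c - a : ℝ) ∧ Feasible L r x a c (s'.realVar 1) ∧
      (∀ μ, Achievable n L r x μ → s'.realVar 1 ≤ μ) ∧
      ∀ i < n, s'.realArr 2 i = plan r x a c (s'.realVar 1) i := by
  obtain ⟨t₁, e₁, l₁⟩ := (show readRange.LoopFree from trivial).exists_exec s
  have i₁ : HoldsScan n L r x (readRange.run s) := by
    refine ⟨⟨?_, ?_, ?_, ?_⟩, ?_, ?_, ?_⟩ <;>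
      simp [readRange, Prog.run, RealExp.eval, NatExp.eval, Store.setReal,
        hn, h0, hr', hx', h2, h3]
  obtain ⟨t₂, s₂, e₂, l₂, i₂, n₂⟩ := exists_exec_loop (b := scanTest) (P := scanStep) trivial
    (HoldsScan n L r x) (fun s => n - s.natVar 2) (fun _ => scanStep_spec) _ i₁
  obtain ⟨t₃, e₃, l₃⟩ := (show emptyBlock.LoopFree from trivial).exists_exec s₂
  have i₃ := holdsBlock_emptyBlock hx i₂ n₂
  obtain ⟨t₄, s₄, e₄, l₄, i₄, n₄⟩ := exists_exec_loop loopFree_growStep (HoldsBlock n L r x)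
    (fun s => s.natVar 1 + (n - s.natVar 2)) (fun _ => growStep_spec hL hr hx hlen) _ i₃
  have hf := not_not.1 ((not_congr (holds_unfinished i₄.toHolds)).1 n₄)
  obtain ⟨t₅, e₅, l₅⟩ := (show startPlan.LoopFree from trivial).exists_exec s₄
  have i₅ : HoldsPlan n L r x (s₄.natVar 1) (s₄.natVar 2) (s₄.realVar 1) (startPlan.run s₄) := by
    refine ⟨⟨?_, ?_, ?_, ?_⟩, ?_, ?_, ?_, ?_, ?_⟩ <;>
      simp [startPlan, Prog.run, RealExp.eval, Store.setReal,
        i₄.num, i₄.len, i₄.range, i₄.pos, i₄.counter, greedy]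
  obtain ⟨t₆, s₆, e₆, l₆, i₆, n₆⟩ := exists_exec_loop loopFree_planStep
    (HoldsPlan n L r x (s₄.natVar 1) (s₄.natVar 2) (s₄.realVar 1))
    (fun s => n - s.natVar 3) (fun _ => planStep_spec) _ i₅
  have hdone : n ≤ s₆.natVar 3 := by
    simpa [planTest, Test.holds, NatExp.eval, i₆.num, Nat.lt_succ_iff] using n₆
  have hac := lt_of_length hL hr hf.1
  refine ⟨_, s₆, s₄.natVar 1, s₄.natVar 2,
    .seq e₁ (.seq e₂ (.seq e₃ (.seq e₄ (.seq e₅ e₆)))), ?_, i₄.block.le_n, hac, hf.1, ?_, ?_, ?_⟩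
  -- The variant counts the sensors outside the block, initially all `n`.
  · have hm : (emptyBlock.run s₂).natVar 1 + (n - (emptyBlock.run s₂).natVar 2) = n := by
      have := i₂.le_n
      simp [emptyBlock, Prog.run, NatExp.eval, Store.setNat]
      omega
    simp only [hm] at l₄
    have l₂' := l₂.trans (Nat.add_le_add_right (Nat.mul_le_mul_left _ (Nat.sub_le _ _)) _)
    have l₆' := l₆.trans (Nat.add_le_add_right (Nat.mul_le_mul_left _ (Nat.sub_le _ _)) _)
    rw [slope, const, add_mul, add_mul]
    omega
  · rw [i₆.value]
    exact (i₄.block.le_iff hac _).1 le_rfl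
  · intro μ hμ
    rw [i₆.value]
    exact i₄.block.le_of_final hL hr hx hf hμ
  · intro i hi
    rw [i₆.value]
    exact i₆.done i (hi.trans_le hdone)

end

/-! ### From the linear bound to the theorem -/

/-- For `n ≥ 3 > e` the logarithm is at least `1`, so `k + m` serves as the constant. -/
theorem isBigO_linear (k m : ℕ) :
    (fun n : ℕ => ((k * n + m : ℕ) : ℝ)) =O[Filter.atTop]
      fun n : ℕ => (n : ℝ) * Real.log (n : ℝ) := by
  refine Asymptotics.IsBigO.of_bound ((k : ℝ) + m) ?_
  filter_upwards [Filter.eventually_ge_atTop 3] with n hn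
  have hn' : (3 : ℝ) ≤ n := by exact_mod_cast hn
  have hlog : 1 ≤ Real.log n := by
    rw [Real.le_log_iff_exp_le (by linarith)]
    exact (Real.exp_one_lt_d9.le.trans (by norm_num)).trans hn'
  have h1 : (n : ℝ) ≤ n * Real.log n := le_mul_of_one_le_right (by linarith) hlog
  rw [Real.norm_of_nonneg (by positivity), Real.norm_of_nonneg (by linarith), add_mul]
  push_cast
  gcongr
  exact le_mul_of_one_le_right (by positivity) (by linarith)

end Uniform

end BarrierCoverage

theorem theorem4 :
    ∃ (P : BarrierCoverage.Prog) (T : ℕ → ℕ),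
      Asymptotics.IsBigO Filter.atTop (fun n : ℕ => (T n : ℝ))
        (fun n : ℕ => (n : ℝ) * Real.log (n : ℝ)) ∧
      ∀ (n : ℕ) (I : BarrierCoverage.Instance n), I.Uniform →
        ∃ (t : ℕ) (s : BarrierCoverage.Store),
          BarrierCoverage.Exec P I.input t s ∧ t ≤ T n ∧
          I.IsOptimal (s.destinations n) ∧
          s.value = I.maxMove (s.destinations n) := by
  open BarrierCoverage Uniform in
  refine ⟨program, fun n => slope * n + const, isBigO_linear _ _, fun n I hI => ?_⟩
  have hn : 0 < n := by
    rcases Nat.eq_zero_or_pos n with rfl | h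
    · have := I.enough
      simp only [Finset.univ_eq_empty, Finset.sum_empty, mul_zero] at this
      exact absurd I.L_pos this.not_gt
    · exact h
  have : Nonempty (Fin n) := ⟨⟨0, hn⟩⟩
  obtain ⟨r, hr⟩ : ∃ r, ∀ i, I.r i = r := ⟨I.r ⟨0, hn⟩, fun i => hI i _⟩
  have hr0 : 0 < r := hr ⟨0, hn⟩ ▸ I.r_pos ⟨0, hn⟩
  have hxi : ∀ i : Fin n, I.input.realArr 0 i = I.x i := fun i => by simp [Instance.input]
  have hlen : I.L ≤ 2 * r * n := by
    have := I.enough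
    simp only [hr, Finset.sum_const, Finset.card_univ, Fintype.card_fin, nsmul_eq_mul] at this
    linarith
  obtain ⟨t, s, a, c, hexec, ht, hcn, hac, hlen', hfeas, hopt, hplan⟩ :=
    exists_exec_program (n := n) (x := I.input.realArr 0) I.L_pos hr0
      (fun i j hij hj => by
        rw [hxi ⟨j, hj⟩, hxi ⟨i, hij.trans_lt hj⟩]
        exact I.x_mono hij)
      hlen (s := I.input) rfl rfl (by simp [Instance.input, hn, hr]) rfl rfl rfl
  -- A covering `z` makes `μ = I.maxMove z` achievable. Applied to the output itself, this also
  -- shows that the reported value is exact.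
  have hle : ∀ z, I.Covers z → s.realVar 1 ≤ I.maxMove z := fun z hz => by
    refine hopt _ ⟨z, fun p hp => ?_, fun i => ?_⟩
    · simpa only [hr] using hz p hp
    · rw [hxi]
      exact le_ciSup (f := fun i => |I.x i - z i|) (Set.finite_range _).bddAbove i
  have hcov : I.Covers (s.destinations n) := fun p hp => by
    obtain ⟨i, hi, hpi⟩ := hfeas.exists_mem_plan hlen' hac hp
    refine ⟨⟨i, hi.trans_le hcn⟩, ?_⟩
    rwa [hr, Store.destinations, hplan i (hi.trans_le hcn)]
  have hmove : I.maxMove (s.destinations n) ≤ s.realVar 1 := ciSup_le fun i => by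
    rw [Store.destinations, hplan i i.isLt, ← hxi]
    exact hfeas.abs_sub_plan_le hlen' hac i
  exact ⟨t, s, hexec, ht, ⟨hcov, fun z hz => hmove.trans (hle z hz)⟩,
    le_antisymm (hle _ hcov) hmove⟩
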